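/- Let $G\subset S_N^+$ be a closed subgroup of the quantum permutation group. That is, $C(G)$ is a unital $C^*$-algebra generated by the entries of an $N\times N$ magic unitary $u=(u_{ij})$ (a matrix of projections summing to $1$ on each row and each column), with a morphism $\Delta:C(G)\to C(G)\otimes C(G)$ (minimal tensor product) satisfying $\Delta(u_{ij})=\sum_k u_{ik}\otimes u_{kj}$. The orbits of $G$ are the equivalence classes of the relation $i\sim j\iff u_{ij}\neq 0$ on $\{1,\ldots,N\}$. Assume that $G$ is quasi-transitive with orbits of size $K$, i.e. all the orbits have exactly $K$ elements. Let $X$ be a connected compact Hausdorff space with a Borel probability measure, and let $\pi:C(G)\to M_K(C(X))$ be a morphism of unital $C^*$-algebras, written $u_{ij}\mapsto (x\mapsto P_{ij}^x)$. Assume that $\pi$ is stationary, i.e. $\int_G=\left(tr\otimes\int_X\right)\pi$, where $\int_G$ is the Haar integration of $G$ (the unique state $h$ of $C(G)$ with $(h\otimes id)\Delta(a)=h(a)1=(id\otimes h)\Delta(a)$ for all $a$) and $tr$ is the normalized trace of $M_K(\mathbb C)$. Then $\pi$ is quasi-flat: whenever $u_{ij}\neq 0$, the matrix $P_{ij}^x\in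 M_K(\mathbb C)$ is a rank-one projection for every $x\in X$. -/

import Mathlib

open scoped TensorProduct ComplexOrder InnerProductSpace

noncomputable section

namespace QPerm

universe u v

/-! ## States and the universal representation of a unital C⋆-algebra -/

/-- The states of a unital C⋆-algebra: positive linear functionals `φ` with `φ 1 = 1`. -/
abbrev State (A : Type u) [CStarAlgebra A] [PartialOrder A] : Type u :=
  {φ : A →ₚ[ℂ] ℂ // φ 1 = 1}

section Universal

variable (A : Type u) [CStarAlgebra A] [PartialOrder A] [StarOrderedRing A]

/-- The Hilbert space of the universal representation: the Hilbert sum of the GNS spaces of all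
the states. -/
def UnivSpace : Type u := lp (fun φ : State A => φ.1.GNS) 2

instance : NormedAddCommGroup (UnivSpace A) :=
  inferInstanceAs (NormedAddCommGroup (lp (fun φ : State A => φ.1.GNS) 2))

instance : InnerProductSpace ℂ (UnivSpace A) :=
  inferInstanceAs (InnerProductSpace ℂ (lp (fun φ : State A => φ.1.GNS) 2))

instance : CompleteSpace (UnivSpace A) :=
  inferInstanceAs (CompleteSpace (lp (fun φ : State A => φ.1.GNS) 2))

variable {A}

/-- The component of a vector at the state `φ`. -/
def UnivSpace.comp (x : UnivSpace A) (φ : State A) : φ.1.GNS :=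
  (show lp (fun φ : State A => φ.1.GNS) 2 from x) φ

theorem UnivSpace.ext {x y : UnivSpace A} (h : ∀ φ, x.comp φ = y.comp φ) : x = y :=
  lp.ext (funext h)

theorem norm_gns_le (φ : State A) (a : A) : ‖φ.1.gnsStarAlgHom a‖ ≤ ‖a‖ :=
  NonUnitalStarAlgHom.norm_apply_le φ.1.gnsStarAlgHom a

/-- The operator `⊕ π_φ(a)` on the Hilbert sum of the GNS spaces. -/
def univOp (a : A) : UnivSpace A →L[ℂ] UnivSpace A :=
  lp.mapCLM 2 (fun φ : State A => φ.1.gnsStarAlgHom a) (norm_nonneg a)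
    (fun φ => norm_gns_le φ a)

theorem univOp_comp (a : A) (x : UnivSpace A) (φ : State A) :
    (univOp a x).comp φ = φ.1.gnsStarAlgHom a (x.comp φ) := rfl

theorem UnivSpace.op_ext {S T : UnivSpace A →L[ℂ] UnivSpace A}
    (h : ∀ x φ, (S x).comp φ = (T x).comp φ) : S = T :=
  ContinuousLinearMap.ext fun x => UnivSpace.ext (h x)

theorem UnivSpace.inner_eq (x y : UnivSpace A) :
    ⟪x, y⟫_ℂ = ∑' φ : State A, ⟪x.comp φ, y.comp φ⟫_ℂ :=
  lp.inner_eq_tsum (𝕜 := ℂ) (G := fun φ : State A => φ.1.GNS) x y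

/-- The universal representation `⊕ π_φ` of a unital C⋆-algebra (the direct sum of the GNS
representations of all its states). -/
def univRep : A →⋆ₐ[ℂ] (UnivSpace A →L[ℂ] UnivSpace A) where
  toFun := univOp
  map_one' := UnivSpace.op_ext fun x φ => by
    rw [univOp_comp, map_one]; rfl
  map_mul' a b := UnivSpace.op_ext fun x φ => by
    rw [univOp_comp, map_mul]; rfl
  map_zero' := UnivSpace.op_ext fun x φ => by
    rw [univOp_comp, map_zero]; rfl
  map_add' a b := UnivSpace.op_ext fun x φ => by
    rw [univOp_comp, map_add]; rfl
  commutes' r := UnivSpace.op_ext fun x φ => by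
    rw [univOp_comp, AlgHomClass.commutes]; rfl
  map_star' a := by
    rw [ContinuousLinearMap.star_eq_adjoint, ContinuousLinearMap.eq_adjoint_iff]
    intro x y
    rw [UnivSpace.inner_eq, UnivSpace.inner_eq]
    refine tsum_congr fun φ => ?_
    rw [univOp_comp, univOp_comp, map_star, ContinuousLinearMap.star_eq_adjoint,
      ContinuousLinearMap.adjoint_inner_left]

end Universal

/-! ## The minimal (spatial) tensor product of C⋆-algebras -/

section MinTensor

/-- The Hilbert space tensor product: the completion of the algebraic tensor product. -/
def HilbertTensor (H : Type u) (K : Type v) [NormedAddCommGroup H] [InnerProductSpace ℂ H]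
    [NormedAddCommGroup K] [InnerProductSpace ℂ K] : Type (max u v) :=
  UniformSpace.Completion (H ⊗[ℂ] K)

section Op

variable {H : Type u} {K : Type v} [NormedAddCommGroup H] [InnerProductSpace ℂ H]
  [NormedAddCommGroup K] [InnerProductSpace ℂ K]

instance : NormedAddCommGroup (HilbertTensor H K) :=
  inferInstanceAs (NormedAddCommGroup (UniformSpace.Completion (H ⊗[ℂ] K)))

instance : InnerProductSpace ℂ (HilbertTensor H K) :=
  inferInstanceAs (InnerProductSpace ℂ (UniformSpace.Completion (H ⊗[ℂ] K)))

instance : CompleteSpace (HilbertTensor H K) :=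
  inferInstanceAs (CompleteSpace (UniformSpace.Completion (H ⊗[ℂ] K)))

/-- The inclusion of the algebraic tensor product into the Hilbert space tensor product. -/
def HilbertTensor.incl : H ⊗[ℂ] K →ₗᵢ[ℂ] HilbertTensor H K :=
  UniformSpace.Completion.toComplₗᵢ

theorem HilbertTensor.denseRange_incl :
    DenseRange (HilbertTensor.incl : H ⊗[ℂ] K →ₗᵢ[ℂ] HilbertTensor H K) :=
  UniformSpace.Completion.denseRange_coe

/-- The operator `S ⊗ T` on the Hilbert space tensor product. -/
def tensorOp (S : H →L[ℂ] H) (T : K →L[ℂ] K) : HilbertTensor H K →L[ℂ] HilbertTensor H K :=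
  (TensorProduct.mapL S T).completion

theorem tensorOp_incl (S : H →L[ℂ] H) (T : K →L[ℂ] K) (x : H ⊗[ℂ] K) :
    tensorOp S T (HilbertTensor.incl x) = HilbertTensor.incl (TensorProduct.mapL S T x) :=
  ContinuousLinearMap.completion_apply_coe _ _

theorem op_ext {S T : HilbertTensor H K →L[ℂ] HilbertTensor H K}
    (h : ∀ x : H ⊗[ℂ] K, S (HilbertTensor.incl x) = T (HilbertTensor.incl x)) : S = T :=
  DFunLike.coe_injective <|
    HilbertTensor.denseRange_incl.equalizer S.continuous T.continuous (funext h)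

theorem tensorOp_mul (S S' : H →L[ℂ] H) (T T' : K →L[ℂ] K) :
    tensorOp (S * S') (T * T') = tensorOp S T * tensorOp S' T' :=
  op_ext fun x => by
    rw [mul_apply_eq_comp, tensorOp_incl, tensorOp_incl, tensorOp_incl,
      TensorProduct.mapL_mul]; rfl

theorem tensorOp_one : tensorOp (1 : H →L[ℂ] H) (1 : K →L[ℂ] K) = 1 :=
  op_ext fun x => by
    rw [tensorOp_incl]
    exact congrArg HilbertTensor.incl
      (DFunLike.congr_fun (TensorProduct.mapL_id_id (𝕜 := ℂ) (E := H) (G := K)) x)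

/-- The operator `S ⊗ T`, as a bilinear function of `S` and `T`. -/
def tensorOpₗ : (H →L[ℂ] H) →ₗ[ℂ] (K →L[ℂ] K) →ₗ[ℂ]
    (HilbertTensor H K →L[ℂ] HilbertTensor H K) :=
  LinearMap.mk₂ ℂ tensorOp
    (fun S S' T => op_ext fun x => by
      rw [add_apply, tensorOp_incl, tensorOp_incl, tensorOp_incl,
        TensorProduct.mapL_add_left, add_apply,
        map_add])
    (fun c S T => op_ext fun x => by
      rw [smul_apply, tensorOp_incl, tensorOp_incl,
        TensorProduct.mapL_smul_left, smul_apply,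
        map_smul])
    (fun S T T' => op_ext fun x => by
      rw [add_apply, tensorOp_incl, tensorOp_incl, tensorOp_incl,
        TensorProduct.mapL_add_right, add_apply,
        map_add])
    (fun c S T => op_ext fun x => by
      rw [smul_apply, tensorOp_incl, tensorOp_incl,
        TensorProduct.mapL_smul_right, smul_apply,
        map_smul])

theorem tensorOp_star [CompleteSpace H] [CompleteSpace K] (S : H →L[ℂ] H) (T : K →L[ℂ] K) :
    tensorOp (star S) (star T) = star (tensorOp S T) := by
  rw [ContinuousLinearMap.star_eq_adjoint (tensorOp S T), ContinuousLinearMap.eq_adjoint_iff]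
  intro x y
  refine HilbertTensor.denseRange_incl.induction_on₂
    (p := fun x y => ⟪tensorOp (star S) (star T) x, y⟫_ℂ = ⟪x, tensorOp S T y⟫_ℂ) ?_ ?_ x y
  · apply isClosed_eq <;> fun_prop
  · intro x y
    rw [tensorOp_incl, tensorOp_incl, LinearIsometry.inner_map_map,
      LinearIsometry.inner_map_map]
    induction x using TensorProduct.induction_on with
    | zero => simp
    | add x x' hx hx' => simp only [map_add, inner_add_left, hx, hx']
    | tmul a b =>
      induction y using TensorProduct.induction_on with
      | zero => simp
      | add y y' hy hy' => simp only [map_add, inner_add_right, hy, hy']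
      | tmul c d =>
        rw [TensorProduct.mapL_tmul, TensorProduct.mapL_tmul, TensorProduct.inner_tmul,
          TensorProduct.inner_tmul, ContinuousLinearMap.star_eq_adjoint,
          ContinuousLinearMap.star_eq_adjoint, ContinuousLinearMap.adjoint_inner_left,
          ContinuousLinearMap.adjoint_inner_left]

/-- `π ⊗ ρ : A ⊗ B → B(H ⊗ K)`, for representations `π : A → B(H)` and `ρ : B → B(K)`, on the
algebraic tensor product `A ⊗ B`. -/
def tensorRep [CompleteSpace H] [CompleteSpace K] {A : Type u} [CStarAlgebra A]
    {B : Type v} [CStarAlgebra B] (π : A →⋆ₐ[ℂ] (H →L[ℂ] H)) (ρ : B →⋆ₐ[ℂ] (K →L[ℂ] K)) :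
    A ⊗[ℂ] B →ₐ[ℂ] (HilbertTensor H K →L[ℂ] HilbertTensor H K) :=
  Algebra.TensorProduct.algHomOfLinearMapTensorProduct
    (TensorProduct.lift (tensorOpₗ.compl₁₂ (π : A →ₗ[ℂ] (H →L[ℂ] H))
      (ρ : B →ₗ[ℂ] (K →L[ℂ] K))))
    (fun a a' b b' => by
      change tensorOp (π (a * a')) (ρ (b * b')) =
        tensorOp (π a) (ρ b) * tensorOp (π a') (ρ b')
      rw [map_mul, map_mul, tensorOp_mul])
    (by
      change tensorOp (π (1 : A)) (ρ (1 : B)) = 1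
      rw [map_one, map_one, tensorOp_one])

theorem tensorRep_tmul [CompleteSpace H] [CompleteSpace K] {A : Type u} [CStarAlgebra A]
    {B : Type v} [CStarAlgebra B] (π : A →⋆ₐ[ℂ] (H →L[ℂ] H)) (ρ : B →⋆ₐ[ℂ] (K →L[ℂ] K))
    (a : A) (b : B) : tensorRep π ρ (a ⊗ₜ b) = tensorOp (π a) (ρ b) := rfl

/-- `π ⊗ ρ` as a morphism of `*`-algebras. -/
def tensorStarRep [CompleteSpace H] [CompleteSpace K] {A : Type u} [CStarAlgebra A]
    {B : Type v} [CStarAlgebra B] (π : A →⋆ₐ[ℂ] (H →L[ℂ] H)) (ρ : B →⋆ₐ[ℂ] (K →L[ℂ] K)) :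
    A ⊗[ℂ] B →⋆ₐ[ℂ] (HilbertTensor H K →L[ℂ] HilbertTensor H K) :=
  { tensorRep π ρ with
    map_star' := fun x => by
      change tensorRep π ρ (star x) = star (tensorRep π ρ x)
      induction x using TensorProduct.induction_on with
      | zero => simp
      | add x y hx hy => rw [star_add, map_add, map_add, star_add, hx, hy]
      | tmul a b =>
        rw [TensorProduct.star_tmul, tensorRep_tmul, tensorRep_tmul, map_star, map_star,
          tensorOp_star] }

/-- The norm closure of the image of `π ⊗ ρ`. -/
def spatialTensor [CompleteSpace H] [CompleteSpace K] {A : Type u} [CStarAlgebra A]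
    {B : Type v} [CStarAlgebra B] (π : A →⋆ₐ[ℂ] (H →L[ℂ] H)) (ρ : B →⋆ₐ[ℂ] (K →L[ℂ] K)) :
    StarSubalgebra ℂ (HilbertTensor H K →L[ℂ] HilbertTensor H K) :=
  (tensorStarRep π ρ).range.topologicalClosure

/-- The norm closure of the image of `π ⊗ ρ`, as a C⋆-algebra. -/
def SpatialTensor [CompleteSpace H] [CompleteSpace K] {A : Type u} [CStarAlgebra A]
    {B : Type v} [CStarAlgebra B] (π : A →⋆ₐ[ℂ] (H →L[ℂ] H)) (ρ : B →⋆ₐ[ℂ] (K →L[ℂ] K)) :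
    Type (max u v) :=
  spatialTensor π ρ

instance [CompleteSpace H] [CompleteSpace K] {A : Type u} [CStarAlgebra A]
    {B : Type v} [CStarAlgebra B] (π : A →⋆ₐ[ℂ] (H →L[ℂ] H)) (ρ : B →⋆ₐ[ℂ] (K →L[ℂ] K)) :
    CStarAlgebra (SpatialTensor π ρ) :=
  haveI : IsClosed (spatialTensor π ρ : Set (HilbertTensor H K →L[ℂ] HilbertTensor H K)) :=
    StarSubalgebra.isClosed_topologicalClosure (tensorStarRep π ρ).range
  inferInstanceAs (CStarAlgebra (spatialTensor π ρ))

/-- The elementary tensor `π(a) ⊗ ρ(b)`. -/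
def SpatialTensor.tmul [CompleteSpace H] [CompleteSpace K] {A : Type u} [CStarAlgebra A]
    {B : Type v} [CStarAlgebra B] (π : A →⋆ₐ[ℂ] (H →L[ℂ] H)) (ρ : B →⋆ₐ[ℂ] (K →L[ℂ] K))
    (a : A) (b : B) : SpatialTensor π ρ :=
  (⟨tensorStarRep π ρ (a ⊗ₜ[ℂ] b),
    StarSubalgebra.le_topologicalClosure (tensorStarRep π ρ).range ⟨a ⊗ₜ[ℂ] b, rfl⟩⟩ :
      spatialTensor π ρ)

end Op

variable (A : Type u) [CStarAlgebra A] [PartialOrder A] [StarOrderedRing A]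
  (B : Type v) [CStarAlgebra B] [PartialOrder B] [StarOrderedRing B]

/-- The minimal (spatial) C⋆-tensor product `A ⊗ B`: the norm closure of the image of the
algebraic tensor product under `π_A ⊗ π_B`, where `π_A`, `π_B` are the universal (faithful)
representations. -/
abbrev MinTensor : Type (max u v) :=
  SpatialTensor (univRep (A := A)) (univRep (A := B))

variable {A B}

/-- The elementary tensor `a ⊗ b` in the minimal C⋆-tensor product. -/
def minTmul (a : A) (b : B) : MinTensor A B :=
  SpatialTensor.tmul univRep univRep a b

end MinTensor

/-! ## Closed subgroups of the quantum permutation group -/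

/-- A magic unitary: a square matrix of projections, summing up to `1` on each row and on each
column. -/
structure IsMagicUnitary {N : ℕ} {A : Type u} [CStarAlgebra A]
    (w : Matrix (Fin N) (Fin N) A) : Prop where
  isStarProjection : ∀ i j, IsStarProjection (w i j)
  row_sum : ∀ i, ∑ j, w i j = 1
  col_sum : ∀ j, ∑ i, w i j = 1

/-- The data of a closed subgroup `G ⊆ S_N⁺` of the quantum permutation group, with `C(G) = A`:
a magic unitary `u` (the fundamental corepresentation) whose entries generate the unital
C⋆-algebra `A`, together with a comultiplication `Δ : A → A ⊗ A` (a morphism of unital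
C⋆-algebras) satisfying `Δ(u_ij) = ∑ₖ u_ik ⊗ u_kj`. By universality of `C(S_N⁺)` this is the same
as a quotient map `C(S_N⁺) → A`, mapping standard generators to the `u_ij`, through which the
comultiplication descends. -/
structure QuantumPermGroup (N : ℕ) (A : Type u) [CStarAlgebra A] [PartialOrder A]
    [StarOrderedRing A] where
  /-- The fundamental corepresentation. -/
  u : Matrix (Fin N) (Fin N) A
  isMagicUnitary : IsMagicUnitary u
  generates : (StarAlgebra.adjoin ℂ {a : A | ∃ i j, u i j = a}).topologicalClosure = ⊤
  /-- The comultiplication. -/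
  comul : A →⋆ₐ[ℂ] MinTensor A A
  comul_u : ∀ i j, comul (u i j) = ∑ k, minTmul (u i k) (u k j)

namespace QuantumPermGroup

variable {N : ℕ} {A : Type u} [CStarAlgebra A] [PartialOrder A] [StarOrderedRing A]
  (G : QuantumPermGroup N A)

/-- The orbit of `i`: its class for the equivalence relation `i ∼ j ↔ u_ij ≠ 0`. -/
def orbit (i : Fin N) : Set (Fin N) := {j | G.u i j ≠ 0}

/-- `G` is quasi-transitive with orbits of size `K`. -/
def IsQuasiTransitive (K : ℕ) : Prop := ∀ i, (G.orbit i).ncard = K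

/-- `L` is the slice map `φ ⊗ id : A ⊗ A → A`; elementary tensors being total, there is at most
one such bounded map. -/
def IsLeftSlice (φ : State A) (L : MinTensor A A →L[ℂ] A) : Prop :=
  ∀ a b : A, L (minTmul a b) = φ.1 a • b

/-- `R` is the slice map `id ⊗ φ : A ⊗ A → A`. -/
def IsRightSlice (φ : State A) (R : MinTensor A A →L[ℂ] A) : Prop :=
  ∀ a b : A, R (minTmul a b) = φ.1 b • a

/-- `h` is the Haar integration `∫_G` of `G`, that is, the (unique) state with
`(h ⊗ id) Δ(a) = h(a) 1 = (id ⊗ h) Δ(a)` for all `a`. -/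
def IsHaarState (h : State A) : Prop :=
  (∃ L, IsLeftSlice h L ∧ ∀ a : A, L (G.comul a) = h.1 a • (1 : A)) ∧
  (∃ R, IsRightSlice h R ∧ ∀ a : A, R (G.comul a) = h.1 a • (1 : A))

section Models

variable {X : Type v} [TopologicalSpace X] {K : ℕ}

/-- The fiber at `x : X` of the image of `a` under a matrix model `π : A → M_K(C(X))`. -/
def fiber (π : A →⋆ₐ[ℂ] Matrix (Fin K) (Fin K) C(X, ℂ)) (a : A) (x : X) :
    Matrix (Fin K) (Fin K) ℂ :=
  (π a).map fun f => f x

/-- The matrix model `π : C(G) → M_K(C(X))` is stationary, with respect to the probability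
measure `μ` on `X`: `∫_G = (tr ⊗ ∫_X) π`, with `tr` the normalized trace. -/
def IsStationary [MeasurableSpace X] (μ : MeasureTheory.Measure X)
    (π : A →⋆ₐ[ℂ] Matrix (Fin K) (Fin K) C(X, ℂ)) : Prop :=
  ∃ h : State A, G.IsHaarState h ∧
    ∀ a : A, h.1 a = ∫ x, (K : ℂ)⁻¹ * (fiber π a x).trace ∂μ

/-- The matrix model `π : C(G) → M_K(C(X))`, `u_ij ↦ P_ij^x`, is quasi-flat: if `u_ij ≠ 0`, then
`P_ij^x` is a rank one projection for any `x`. -/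
def IsQuasiFlat (π : A →⋆ₐ[ℂ] Matrix (Fin K) (Fin K) C(X, ℂ)) : Prop :=
  ∀ i j, G.u i j ≠ 0 → ∀ x : X,
    IsStarProjection (fiber π (G.u i j) x) ∧ (fiber π (G.u i j) x).rank = 1

end Models

end QuantumPermGroup

end QPerm

end

/-!
The Haar state of a quasi-transitive quantum permutation group is explicit on the generators:
it takes the value `K⁻¹` at every nonzero `u i j` (`QPerm.QuantumPermGroup.haar_u`). By invariance
`∑ k, h (u i k) • u k j = h (u i j) • 1`; multiplying by `u l j`, which is orthogonal to the other
entries of the column `j`, gives `h (u i l) = h (u i j)` as soon as `u l j ≠ 0`. With `l = i`, the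
state `h` takes a single value on the nonzero entries of the row `i`; there are `K` of these and they
sum to `1`.

Let now `π` be a stationary model. Each fiber of `u i j` is a projection matrix, so its rank is its
trace, and hence depends continuously on the point. As `X` is connected the rank is constant, and
stationarity identifies `K⁻¹` times this constant with `h (u i j) = K⁻¹`.
-/

namespace QPerm

/-- A sub-sum of a sum of projections equal to `1` is at most `1`, so each of the two projections
lies below the complement of the other. -/
theorem mul_eq_zero_of_isStarProjection_sum_eq_one {ι A : Type*} [Fintype ι] [CStarAlgebra A]
    [PartialOrder A] [StarOrderedRing A] {p : ι → A} (hp : ∀ i, IsStarProjection (p i))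
    (hsum : ∑ i, p i = 1) {i j : ι} (hij : i ≠ j) : p i * p j = 0 := by
  classical
  have hle : p i + p j ≤ 1 := by
    rw [← hsum, ← Finset.sum_pair hij]
    exact Finset.sum_le_sum_of_subset_of_nonneg (Finset.subset_univ _)
      fun k _ _ => (hp k).nonneg
  have h := ((hp i).le_iff_mul_eq_left (hp j).one_sub).1 (le_sub_iff_add_le.2 hle)
  simpa [mul_sub] using h

theorem trace_eq_rank_of_isIdempotentElem {n 𝕜 : Type*} [Fintype n] [DecidableEq n] [Field 𝕜]
    {P : Matrix n n 𝕜} (hP : IsIdempotentElem P) : P.trace = P.rank := by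
  have h : IsIdempotentElem (Matrix.toLin' P) := hP.map Matrix.toLinAlgEquiv'
  have h' := (LinearMap.IsIdempotentElem.isProj_range _ h).trace
  rwa [Matrix.trace_toLin'_eq] at h'

namespace QuantumPermGroup

section Haar

variable {N : ℕ} {A : Type*} [CStarAlgebra A] [PartialOrder A] [StarOrderedRing A]
  (G : QuantumPermGroup N A)

theorem sum_haar_smul_u {h : State A} (hh : G.IsHaarState h) (i j : Fin N) :
    ∑ k, h.1 (G.u i k) • G.u k j = h.1 (G.u i j) • (1 : A) := by
  obtain ⟨⟨L, hL, hinv⟩, -⟩ := hh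
  rw [← hinv, G.comul_u, map_sum]
  exact Finset.sum_congr rfl fun k _ => (hL _ _).symm

theorem haar_u_eq {h : State A} (hh : G.IsHaarState h) (i : Fin N) {l j : Fin N}
    (hlj : G.u l j ≠ 0) : h.1 (G.u i l) = h.1 (G.u i j) := by
  have hs := congrArg (G.u l j * ·) (G.sum_haar_smul_u hh i j)
  simp only [Finset.mul_sum, mul_smul_comm, mul_one] at hs
  rw [Finset.sum_eq_single l, (G.isMagicUnitary.isStarProjection l j).isIdempotentElem.eq] at hs
  · exact smul_left_injective ℂ hlj hs
  · intro k _ hk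
    rw [mul_eq_zero_of_isStarProjection_sum_eq_one (p := fun k => G.u k j)
      (fun k => G.isMagicUnitary.isStarProjection k j) (G.isMagicUnitary.col_sum j) hk.symm,
      smul_zero]
  · simp

/-- The Haar state takes the same value at all the nonzero entries of a row, namely the inverse of
the size of the orbit. -/
theorem haar_u {K : ℕ} (hG : G.IsQuasiTransitive K) {h : State A} (hh : G.IsHaarState h)
    {i j : Fin N} (hij : G.u i j ≠ 0) : h.1 (G.u i j) = (K : ℂ)⁻¹ := by
  classical
  have hsum : ∑ k, h.1 (G.u i k) = 1 := by
    rw [← map_sum, G.isMagicUnitary.row_sum, h.2]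
  have hcard : (Finset.univ.filter fun k => G.u i k ≠ 0).card = K := by
    rw [← hG i, ← Set.ncard_coe_finset]
    simp [orbit]
  have hconst : ∀ k, G.u i k ≠ 0 → h.1 (G.u i k) = h.1 (G.u i j) := fun k hk =>
    (G.haar_u_eq hh i hk).symm.trans (G.haar_u_eq hh i hij)
  rw [← Finset.sum_filter_of_ne (p := fun k => G.u i k ≠ 0)
      fun k _ hk h0 => hk (by rw [h0, map_zero]),
    Finset.sum_congr rfl fun k hk => hconst k (Finset.mem_filter.1 hk).2,
    Finset.sum_const, hcard, nsmul_eq_mul] at hsum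
  exact eq_inv_of_mul_eq_one_right hsum

end Haar

section Models

variable {A : Type*} [CStarAlgebra A] {X : Type*} [TopologicalSpace X] {K : ℕ}

theorem isStarProjection_fiber (π : A →⋆ₐ[ℂ] Matrix (Fin K) (Fin K) C(X, ℂ)) {p : A}
    (hp : IsStarProjection p) (x : X) : IsStarProjection (fiber π p x) := by
  have hmul := hp.isIdempotentElem.eq
  have hstar := hp.isSelfAdjoint.star_eq
  constructor
  · have h := congrArg (fun M => M.map fun f : C(X, ℂ) => f x) (map_mul π p p)
    rw [hmul] at h
    refine Eq.trans ?_ h.symm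
    ext a b
    simp [fiber, Matrix.mul_apply]
  · have h := congrArg (fun M => M.map fun f : C(X, ℂ) => f x) (map_star π p)
    rw [hstar] at h
    refine Eq.trans ?_ h.symm
    ext a b
    simp [fiber, Matrix.star_apply]

theorem continuous_trace_fiber (π : A →⋆ₐ[ℂ] Matrix (Fin K) (Fin K) C(X, ℂ)) (a : A) :
    Continuous fun x => (fiber π a x).trace := by
  simp only [Matrix.trace, Matrix.diag, fiber, Matrix.map_apply]
  fun_prop

/-- On a connected space, the fibers of a projection all have the same rank. -/
theorem rank_fiber_eq [PreconnectedSpace X] (π : A →⋆ₐ[ℂ] Matrix (Fin K) (Fin K) C(X, ℂ))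
    {p : A} (hp : IsStarProjection p) (x y : X) :
    (fiber π p x).rank = (fiber π p y).rank := by
  have htrace : ∀ x, (fiber π p x).trace = (fiber π p x).rank := fun x =>
    trace_eq_rank_of_isIdempotentElem (isStarProjection_fiber π hp x).isIdempotentElem
  refine PreconnectedSpace.constant ‹_› (f := fun x => (fiber π p x).rank) ?_
  rw [Nat.isClosedEmbedding_coe_real.isInducing.continuous_iff]
  convert Complex.continuous_re.comp (continuous_trace_fiber π p) using 1
  ext x
  simp [htrace]

end Models

end QuantumPermGroup

end QPerm

theorem theorem5p6 {N K : ℕ} {A : Type*} [CStarAlgebra A] [PartialOrder A] [StarOrderedRing A]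
    (G : QPerm.QuantumPermGroup N A) (hG : G.IsQuasiTransitive K)
    {X : Type*} [TopologicalSpace X] [CompactSpace X] [T2Space X] [ConnectedSpace X]
    [MeasurableSpace X] [BorelSpace X]
    (μ : MeasureTheory.Measure X) [MeasureTheory.IsProbabilityMeasure μ]
    (π : A →⋆ₐ[ℂ] Matrix (Fin K) (Fin K) C(X, ℂ)) (hπ : G.IsStationary μ π) :
    G.IsQuasiFlat π := by
  intro i j hij x
  have hp := G.isMagicUnitary.isStarProjection i j
  refine ⟨QPerm.QuantumPermGroup.isStarProjection_fiber π hp x, ?_⟩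
  obtain ⟨h, hh, hint⟩ := hπ
  have hK : (K : ℂ) ≠ 0 := by
    have hne : (G.orbit i).ncard ≠ 0 := Set.ncard_ne_zero_of_mem (a := j) hij
    rw [hG i] at hne
    exact_mod_cast hne
  have htrace : ∀ y, (QPerm.QuantumPermGroup.fiber π (G.u i j) y).trace =
      (QPerm.QuantumPermGroup.fiber π (G.u i j) x).rank := fun y => by
    rw [QPerm.trace_eq_rank_of_isIdempotentElem
      (QPerm.QuantumPermGroup.isStarProjection_fiber π hp y).isIdempotentElem,
      QPerm.QuantumPermGroup.rank_fiber_eq π hp y x]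
  have key := hint (G.u i j)
  simp only [htrace, MeasureTheory.integral_const, MeasureTheory.probReal_univ, one_smul,
    G.haar_u hG hh hij] at key
  have hone := mul_left_cancel₀ (inv_ne_zero hK) ((mul_one _).trans key)
  exact_mod_cast hone.symm
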